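/- **Theorem (Hölder estimates).** Let $n\ge 1$, $0<s<1$, $k\ge 0$ an integer, $0<\alpha\le 1$, and let $u\in C^{k,\alpha}(\mathbb{R}^n)$, i.e. $u$ is $k$ times continuously differentiable and $$\|u\|_{C^{k,\alpha}(\mathbb{R}^n)}=\sum_{j=0}^{k}\sup_{x}|D^ju(x)|+\sup_{x\ne y}\frac{|D^ku(x)-D^ku(y)|}{|x-y|^\alpha}<\infty .$$ The fractional Laplacian $(-\Delta)^su$ is understood in the sense of tempered distributions: $\langle(-\Delta)^su,\varphi\rangle=\int_{\mathbb{R}^n}u\,(-\Delta)^s\varphi\,dx$ for every Schwartz function $\varphi$, where $\widehat{(-\Delta)^s\varphi}(\xi)=|\xi|^{2s}\widehat\varphi(\xi)$ (with $\widehat\varphi(\xi)=\int e^{-ix\cdot\xi}\varphi(x)\,dx$). (i) If $2s<\alpha$, then $(-\Delta)^su\in C^{k,\alpha-2s}(\mathbb{R}^n)$ and $$\|(-\Delta)^su\|_{C^{k,\alpha-2s}(\mathbb{R}^n)}\le C\,\|u\|_{C^{k,\alpha}(\mathbb{R}^n)} .$$ (ii) If $\alpha<2s<1+\alpha$ and $k\ge1$,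 then $(-\Delta)^su\in C^{k-1,\alpha-2s+1}(\mathbb{R}^n)$ and $$\|(-\Delta)^su\|_{C^{k-1,\alpha-2s+1}(\mathbb{R}^n)}\le C\,\|u\|_{C^{k,\alpha}(\mathbb{R}^n)} .$$ The constants $C>0$ depend only on $n$, $s$, $k$ and $\alpha$. -/

import Mathlib

open MeasureTheory
open scoped NNReal ENNReal FourierTransform SchwartzMap

noncomputable section

/-- The norm of `C^{k,α}(ℝⁿ)`, with values in `[0, ∞]`: the sum of the sup-norms of all derivatives
of order `≤ k`, plus the `α`-Hölder seminorm of the derivative of order `k`. It is only meaningful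
for `C^k` functions and for `0 < α`; compare `MemHolderSpace`. -/
def holderSpaceNorm {n : ℕ} (k : ℕ) (α : ℝ) (u : EuclideanSpace ℝ (Fin n) → ℂ) : ℝ≥0∞ :=
  (∑ j ∈ Finset.range (k + 1), ⨆ x, ‖iteratedFDeriv ℝ j u x‖ₑ) +
    eHolderNorm α.toNNReal (iteratedFDeriv ℝ k u)

/-- The Hölder space `C^{k,α}(ℝⁿ)`: the `C^k` functions with finite `C^{k,α}` norm. -/
def MemHolderSpace {n : ℕ} (k : ℕ) (α : ℝ) (u : EuclideanSpace ℝ (Fin n) → ℂ) : Prop :=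
  ContDiff ℝ k u ∧ holderSpaceNorm k α u < ∞

/-- `(-Δ)^s φ` for a Schwartz function `φ`, through the Fourier multiplier. With Mathlib's kernel
`exp (-2πi⟨x, ξ⟩)` the symbol of `-Δ` is `(2π‖ξ‖)²`. -/
def schwartzFracLaplacian {n : ℕ} (s : ℝ) (φ : 𝓢(EuclideanSpace ℝ (Fin n), ℂ)) :
    EuclideanSpace ℝ (Fin n) → ℂ :=
  𝓕⁻ (fun ξ : EuclideanSpace ℝ (Fin n) =>
    ((2 * Real.pi * ‖ξ‖) ^ (2 * s) : ℝ) • 𝓕 (φ : EuclideanSpace ℝ (Fin n) → ℂ) ξ)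

/-- The weighted space `L_s`: `∫ |u(x)| / (1 + |x|^{n+2s}) dx < ∞`. -/
def MemLs {n : ℕ} (s : ℝ) (u : EuclideanSpace ℝ (Fin n) → ℂ) : Prop :=
  Integrable (fun x => ((1 + ‖x‖ ^ ((n : ℝ) + 2 * s))⁻¹ : ℝ) • u x)

/-- `(-Δ)^s u = g` in the sense of tempered distributions, for a function `u ∈ L_s` and a function
`g`: `⟨g, φ⟩ = ⟨u, (-Δ)^s φ⟩` for every Schwartz function `φ`, where both pairings are absolutely
convergent integrals. -/
def IsFracLaplacian {n : ℕ} (s : ℝ) (u g : EuclideanSpace ℝ (Fin n) → ℂ) : Prop :=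
  MemLs s u ∧ ∀ φ : 𝓢(EuclideanSpace ℝ (Fin n), ℂ),
    Integrable (fun x => g x * φ x) ∧
    Integrable (fun x => u x * schwartzFracLaplacian s φ x) ∧
    ∫ x, g x * φ x = ∫ x, u x * schwartzFracLaplacian s φ x

end

/-! On Schwartz functions the multiplier `(2π‖ξ‖)^(2s)` is a positive constant `c` times integration
of the symmetric second differences against `‖y‖^(-(n+2s))`: on the Fourier side a second difference
is multiplication by `1 - cos (2π⟨y, ξ⟩)`, and the resulting symbol is radial and homogeneous of
degree `2s` (`exists_fracSymbol_eq`, `fourierInv_fracMultiplier`). The same integral converges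
absolutely for the given `u`, and Fubini with translation invariance moves it across the pairing
with a test function (`integral_hypersingular_mul`). Hence `g = c • hypersingular s u` is the
distributional fractional Laplacian.

The Hölder bounds for `g` rest on one modulus, `‖y‖^a * min (‖y‖^b) (r^b)` with `a < 2s < a + b`.
With `r = 1` it bounds the second differences and gives sup bounds; with `r = ‖x - x'‖` it bounds
their variation from `x` to `x'`, and scaling turns its integral into a multiple of `r^(a+b-2s)`
(`norm_hypersingular_sub_le`). The integral commutes with derivatives
(`iteratedFDeriv_hypersingular`), so every order is treated alike. Case (i) is `a = 0`, `b = α`.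
Case (ii) is `a = α`, `b = 1`: one derivative of `u` is spent to gain a factor `‖y‖` or `r` by the
mean value inequality. -/

noncomputable section

set_option linter.unusedSectionVars false

/-! ### The hypersingular integral and its scaling -/

section Hypersingular

variable {V F G : Type*} [NormedAddCommGroup V] [InnerProductSpace ℝ V] [FiniteDimensional ℝ V]
  [MeasurableSpace V] [BorelSpace V] [NormedAddCommGroup F] [NormedSpace ℝ F]
  [NormedAddCommGroup G] [NormedSpace ℝ G]

/-- The symmetric second difference `v x - (v (x + y) + v (x - y)) / 2`. -/
def symDiff₂ {V F : Type*} [AddGroup V] [AddCommGroup F] [Module ℝ F] (v : V → F) (y x : V) : F :=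
  v x - (1 / 2 : ℝ) • (v (x + y) + v (x - y))

/-- The kernel `‖y‖ ^ (-(d + 2 s))` of the fractional Laplacian on a `d`-dimensional space. -/
def fracKernel (s : ℝ) (y : V) : ℝ := ‖y‖ ^ (-((Module.finrank ℝ V : ℝ) + 2 * s))

/-- The hypersingular integral of the symmetric second differences of `v`. -/
def hypersingular (s : ℝ) (v : V → F) (x : V) : F := ∫ y, fracKernel s y • symDiff₂ v y x

/-- The weight `‖y‖ ^ a * min (‖y‖ ^ b) (r ^ b)`, a modulus for second differences. -/
def diffWeight (a b r : ℝ) (y : V) : ℝ := ‖y‖ ^ a * min (‖y‖ ^ b) (r ^ b)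

lemma fracKernel_nonneg (s : ℝ) (y : V) : 0 ≤ fracKernel s y := by
  unfold fracKernel; positivity

lemma diffWeight_nonneg (a b : ℝ) {r : ℝ} (hr : 0 ≤ r) (y : V) : 0 ≤ diffWeight a b r y := by
  unfold diffWeight; positivity

lemma measurable_fracKernel (s : ℝ) : Measurable (fracKernel s : V → ℝ) := by
  unfold fracKernel; fun_prop

/-- In polar coordinates the radial integrand is `t^(a+b-2s-1)` below `1` and `t^(a-2s-1)` above it;
the two hypotheses are the convergence conditions at `0` and at infinity. -/
lemma integrable_fracKernel_mul_diffWeight [Nontrivial V] {s a b : ℝ}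
    (has : a < 2 * s) (hsab : 2 * s < a + b) :
    Integrable (fun y : V => fracKernel s y * diffWeight a b 1 y) := by
  set d := Module.finrank ℝ V
  have hd : 1 ≤ d := Module.finrank_pos
  have key := (integrable_fun_norm_addHaar (E := V) volume
    (f := fun t : ℝ => t ^ (-((d : ℝ) + 2 * s)) * (t ^ a * min (t ^ b) 1))).2 ?_
  · simpa [fracKernel, diffWeight, d] using key
  have hb : 0 < b := by linarith
  rw [← Set.Ioc_union_Ioi_eq_Ioi zero_le_one]
  refine IntegrableOn.union ?_ ?_
  · rw [integrableOn_Ioc_iff_integrableOn_Ioo]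
    refine ((intervalIntegral.integrableOn_Ioo_rpow_iff (s := a + b - 2 * s - 1) one_pos).2
      (by linarith)).congr_fun (fun t ht => ?_) measurableSet_Ioo
    have ht0 : 0 < t := ht.1
    have h1 : min (t ^ b) 1 = t ^ b := min_eq_left (Real.rpow_le_one ht0.le ht.2.le hb.le)
    simp only [smul_eq_mul, h1]
    rw [← Real.rpow_natCast, ← Real.rpow_add ht0, ← Real.rpow_add ht0, ← Real.rpow_add ht0]
    congr 1
    rw [Nat.cast_sub hd]
    push_cast
    ring
  · refine (integrableOn_Ioi_rpow_of_lt (a := a - 2 * s - 1) (by linarith) one_pos).congr_fun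
      (fun t ht => ?_) measurableSet_Ioi
    have ht1 : 1 < t := ht
    have ht0 : 0 < t := by linarith
    have h1 : min (t ^ b) 1 = 1 := min_eq_right (Real.one_le_rpow ht1.le hb.le)
    simp only [smul_eq_mul, h1, mul_one]
    rw [← Real.rpow_natCast, ← Real.rpow_add ht0, ← Real.rpow_add ht0]
    congr 1
    rw [Nat.cast_sub hd]
    push_cast
    ring

lemma fracKernel_smul (s : ℝ) {r : ℝ} (hr : 0 < r) (y : V) :
    fracKernel s (r • y) = r ^ (-((Module.finrank ℝ V : ℝ) + 2 * s)) * fracKernel s y := by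
  rw [fracKernel, fracKernel, norm_smul, Real.mul_rpow (norm_nonneg _) (norm_nonneg _),
    Real.norm_of_nonneg hr.le]

/-- The kernel is homogeneous of degree `-(d+2s)` in `y`, the weight of degree `a + b` in `(y, r)`
jointly. After integration the Jacobian `r^d` leaves the factor `r^(a+b-2s)`. -/
lemma fracKernel_mul_diffWeight_eq (s a b : ℝ) {r : ℝ} (hr : 0 < r) (y : V) :
    fracKernel s y * diffWeight a b r y = r ^ (a + b - 2 * s - Module.finrank ℝ V) *
      (fracKernel s (r⁻¹ • y) * diffWeight a b 1 (r⁻¹ • y)) := by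
  set z := r⁻¹ • y with hz
  have hy : y = r • z := by simp [hz, smul_smul, hr.ne']
  rw [hy, fracKernel_smul s hr, diffWeight, diffWeight, norm_smul, Real.norm_of_nonneg hr.le,
    Real.mul_rpow hr.le (norm_nonneg _), Real.mul_rpow hr.le (norm_nonneg _)]
  have h1 : min (r ^ b * ‖z‖ ^ b) (r ^ b) = r ^ b * min (‖z‖ ^ b) 1 := by
    rw [mul_min_of_nonneg _ _ (by positivity), mul_one]
  rw [h1, Real.one_rpow]
  have h2 : r ^ (a + b - 2 * s - Module.finrank ℝ V) =
      r ^ (-((Module.finrank ℝ V : ℝ) + 2 * s)) * r ^ a * r ^ b := by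
    rw [← Real.rpow_add hr, ← Real.rpow_add hr]; congr 1; ring
  rw [h2]; ring

lemma integrable_fracKernel_mul_diffWeight_scaled [Nontrivial V] {s a b r : ℝ}
    (has : a < 2 * s) (hsab : 2 * s < a + b) (hr : 0 < r) :
    Integrable (fun y : V => fracKernel s y * diffWeight a b r y) := by
  simp_rw [fracKernel_mul_diffWeight_eq s a b hr]
  exact ((integrable_comp_smul_iff volume
    (fun y : V => fracKernel s y * diffWeight a b 1 y) (inv_ne_zero hr.ne')).2
    (integrable_fracKernel_mul_diffWeight has hsab)).const_mul _

lemma integral_fracKernel_mul_diffWeight_scaled (s a b : ℝ) {r : ℝ} (hr : 0 < r) :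
    ∫ y : V, fracKernel s y * diffWeight a b r y =
      r ^ (a + b - 2 * s) * ∫ y : V, fracKernel s y * diffWeight a b 1 y := by
  simp_rw [fracKernel_mul_diffWeight_eq s a b hr, integral_const_mul]
  rw [Measure.integral_comp_smul volume (fun y : V => fracKernel s y * diffWeight a b 1 y),
    smul_eq_mul, ← mul_assoc]
  congr 1
  rw [inv_pow, inv_inv, abs_of_pos (by positivity), ← Real.rpow_natCast, ← Real.rpow_add hr]
  congr 1; ring

lemma continuous_symDiff₂ {v : V → F} (hv : Continuous v) (y : V) :
    Continuous (symDiff₂ v y) := by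
  unfold symDiff₂; fun_prop

lemma continuous_symDiff₂_uncurry {v : V → F} (hv : Continuous v) :
    Continuous (fun p : V × V => symDiff₂ v p.2 p.1) := by
  unfold symDiff₂; fun_prop

lemma aestronglyMeasurable_fracKernel_smul_symDiff₂ (s : ℝ) {v : V → F} (hv : Continuous v)
    (x : V) : AEStronglyMeasurable (fun y => fracKernel s y • symDiff₂ v y x) :=
  ((measurable_fracKernel s).aestronglyMeasurable).smul
    ((continuous_symDiff₂_uncurry hv).comp (Continuous.prodMk_right x)).aestronglyMeasurable

lemma norm_fracKernel_smul_le {s : ℝ} {y : V} {z : F} {c : ℝ} (h : ‖z‖ ≤ c) :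
    ‖fracKernel s y • z‖ ≤ fracKernel s y * c := by
  rw [norm_smul, Real.norm_of_nonneg (fracKernel_nonneg s y)]
  exact mul_le_mul_of_nonneg_left h (fracKernel_nonneg s y)

lemma integrable_fracKernel_smul_symDiff₂ [Nontrivial V] {s a b M : ℝ} (has : a < 2 * s)
    (hsab : 2 * s < a + b) {v : V → F} (hv : Continuous v) {x : V}
    (h : ∀ y, ‖symDiff₂ v y x‖ ≤ M * diffWeight a b 1 y) :
    Integrable (fun y => fracKernel s y • symDiff₂ v y x) := by
  refine ((integrable_fracKernel_mul_diffWeight has hsab).const_mul M).mono'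
    (aestronglyMeasurable_fracKernel_smul_symDiff₂ s hv x) (ae_of_all _ fun y => ?_)
  exact (norm_fracKernel_smul_le (h y)).trans_eq (by ring)

lemma norm_hypersingular_le [Nontrivial V] {s a b M : ℝ} (has : a < 2 * s)
    (hsab : 2 * s < a + b) {v : V → F} {x : V}
    (h : ∀ y, ‖symDiff₂ v y x‖ ≤ M * diffWeight a b 1 y) :
    ‖hypersingular s v x‖ ≤ M * ∫ y : V, fracKernel s y * diffWeight a b 1 y := by
  rw [← integral_const_mul]
  refine norm_integral_le_of_norm_le
    ((integrable_fracKernel_mul_diffWeight has hsab).const_mul M) (ae_of_all _ fun y => ?_)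
  exact (norm_fracKernel_smul_le (h y)).trans_eq (by ring)

lemma continuous_hypersingular [Nontrivial V] {s a b M : ℝ} (has : a < 2 * s)
    (hsab : 2 * s < a + b) {v : V → F} (hv : Continuous v)
    (h : ∀ x y, ‖symDiff₂ v y x‖ ≤ M * diffWeight a b 1 y) :
    Continuous (hypersingular s v) := by
  refine continuous_of_dominated (fun x => aestronglyMeasurable_fracKernel_smul_symDiff₂ s hv x)
    (fun x => ae_of_all _ fun y => (norm_fracKernel_smul_le (h x y)).trans_eq ?_)
    ((integrable_fracKernel_mul_diffWeight has hsab).const_mul M)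
    (ae_of_all _ fun y => (continuous_symDiff₂ hv y).const_smul _)
  ring

/-- The Hölder exponent `a + b - 2s` comes from rescaling the weight at the radius `r = ‖x - x'‖`.
-/
lemma norm_hypersingular_sub_le [Nontrivial V] {s a b M : ℝ} (has : a < 2 * s)
    (hsab : 2 * s < a + b) {v : V → F} (hv : Continuous v)
    (h : ∀ x y, ‖symDiff₂ v y x‖ ≤ M * diffWeight a b 1 y)
    (h' : ∀ x x' y, ‖symDiff₂ v y x - symDiff₂ v y x'‖ ≤ M * diffWeight a b ‖x - x'‖ y)
    (x x' : V) :
    ‖hypersingular s v x - hypersingular s v x'‖ ≤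
      M * (∫ y : V, fracKernel s y * diffWeight a b 1 y) * ‖x - x'‖ ^ (a + b - 2 * s) := by
  rcases eq_or_ne x x' with rfl | hne
  · simp [Real.zero_rpow (by linarith : a + b - 2 * s ≠ 0)]
  have hr : 0 < ‖x - x'‖ := norm_pos_iff.2 (sub_ne_zero.2 hne)
  rw [mul_assoc, mul_comm (∫ _, _), ← integral_fracKernel_mul_diffWeight_scaled s a b hr,
    ← integral_const_mul, hypersingular, hypersingular,
    ← integral_sub (integrable_fracKernel_smul_symDiff₂ has hsab hv (h x))
      (integrable_fracKernel_smul_symDiff₂ has hsab hv (h x'))]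
  refine norm_integral_le_of_norm_le
    ((integrable_fracKernel_mul_diffWeight_scaled has hsab hr).const_mul M)
    (ae_of_all _ fun y => ?_)
  rw [← smul_sub]
  exact (norm_fracKernel_smul_le (h' x x' y)).trans_eq (by ring)

lemma hasFDerivAt_symDiff₂ {v : V → F} (hv : Differentiable ℝ v) (y x : V) :
    HasFDerivAt (symDiff₂ v y) (symDiff₂ (fderiv ℝ v) y x) x := by
  have h1 : HasFDerivAt (fun x => v (x + y)) (fderiv ℝ v (x + y)) x :=
    (hasFDerivAt_comp_add_right y).2 (hv (x + y)).hasFDerivAt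
  have h2 : HasFDerivAt (fun x => v (x - y)) (fderiv ℝ v (x - y)) x :=
    (hasFDerivAt_comp_sub y).2 (hv (x - y)).hasFDerivAt
  exact (hv x).hasFDerivAt.sub ((h1.add h2).const_smul (1 / 2 : ℝ))

/-- Differentiation under the integral: the derivative of a second difference is the second
difference of the derivative, and its bound is uniform in `x`, so one integrable function dominates.
-/
lemma hasFDerivAt_hypersingular [Nontrivial V] {s a b M M' : ℝ} (has : a < 2 * s)
    (hsab : 2 * s < a + b) {v : V → F} (hv : ContDiff ℝ 1 v)
    (h : ∀ x y, ‖symDiff₂ v y x‖ ≤ M * diffWeight a b 1 y)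
    (h' : ∀ x y, ‖symDiff₂ (fderiv ℝ v) y x‖ ≤ M' * diffWeight a b 1 y) (x : V) :
    HasFDerivAt (hypersingular s v) (hypersingular s (fderiv ℝ v) x) x := by
  refine hasFDerivAt_integral_of_dominated_of_fderiv_le (s := Set.univ) (𝕜 := ℝ)
    (bound := fun y => M' * (fracKernel s y * diffWeight a b 1 y)) Filter.univ_mem
    (Filter.Eventually.of_forall fun x =>
      aestronglyMeasurable_fracKernel_smul_symDiff₂ s hv.continuous x)
    (integrable_fracKernel_smul_symDiff₂ has hsab hv.continuous (h x))
    (aestronglyMeasurable_fracKernel_smul_symDiff₂ s (hv.continuous_fderiv one_ne_zero) x)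
    (ae_of_all _ fun y x _ => (norm_fracKernel_smul_le (h' x y)).trans_eq (by ring))
    ((integrable_fracKernel_mul_diffWeight has hsab).const_mul M')
    (ae_of_all _ fun y x _ => (hasFDerivAt_symDiff₂ (hv.differentiable one_ne_zero) y x).const_smul _)

lemma symDiff₂_comp_linearIsometryEquiv (L : F ≃ₗᵢ[ℝ] G) (v : V → F) (y x : V) :
    symDiff₂ (L ∘ v) y x = L (symDiff₂ v y x) := by
  simp [symDiff₂]

lemma norm_symDiff₂_comp_linearIsometryEquiv (L : F ≃ₗᵢ[ℝ] G) (v : V → F) (y x : V) :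
    ‖symDiff₂ (L ∘ v) y x‖ = ‖symDiff₂ v y x‖ := by
  rw [symDiff₂_comp_linearIsometryEquiv, L.norm_map]

lemma hypersingular_comp_linearIsometryEquiv (s : ℝ) (L : F ≃ₗᵢ[ℝ] G) (v : V → F) :
    hypersingular s (L ∘ v) = L ∘ hypersingular s v := by
  ext x
  simp only [hypersingular, symDiff₂_comp_linearIsometryEquiv, Function.comp_apply, ← map_smul]
  exact L.toContinuousLinearEquiv.integral_comp_comm _

end Hypersingular

/-! ### Elementary bounds on first and second differences -/

section DifferenceBounds

variable {V F : Type*} [NormedAddCommGroup V] [NormedSpace ℝ V]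
  [NormedAddCommGroup F] [NormedSpace ℝ F] {v : V → F} {M α : ℝ}

lemma norm_sub_le_of_norm_fderiv_le (hv : Differentiable ℝ v) (h : ∀ x, ‖fderiv ℝ v x‖ ≤ M)
    (x x' : V) : ‖v x - v x'‖ ≤ M * ‖x - x'‖ :=
  convex_univ.norm_image_sub_le_of_norm_fderiv_le (fun x _ => hv x) (fun x _ => h x)
    (Set.mem_univ _) (Set.mem_univ _)

/-- At distance at most `1` the Lipschitz bound is the better one, beyond it the sup bound. This
gives the derivatives of order below `k` the exponent `α` of the top one. -/
lemma norm_sub_le_rpow_of_bounded_of_lipschitz (hα0 : 0 ≤ α) (hα1 : α ≤ 1) (hM : 0 ≤ M)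
    (hb : ∀ x, ‖v x‖ ≤ M) (hl : ∀ x x', ‖v x - v x'‖ ≤ M * ‖x - x'‖) (x x' : V) :
    ‖v x - v x'‖ ≤ 2 * M * ‖x - x'‖ ^ α := by
  rcases le_total ‖x - x'‖ 1 with h | h
  · have h1 : ‖x - x'‖ ≤ ‖x - x'‖ ^ α := by
      simpa using Real.rpow_le_rpow_of_exponent_ge' (norm_nonneg (x - x')) h hα0 hα1
    have := mul_le_mul_of_nonneg_left h1 hM
    have h2 : 0 ≤ M * ‖x - x'‖ ^ α := by positivity
    linarith [hl x x']
  · have h1 : 1 ≤ ‖x - x'‖ ^ α := Real.one_le_rpow h hα0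
    have := mul_le_mul_of_nonneg_left h1 hM
    linarith [norm_sub_le (v x) (v x'), hb x, hb x']

lemma norm_symDiff₂_le (v : V → F) (y x : V) :
    ‖symDiff₂ v y x‖ ≤ 1 / 2 * (‖v x - v (x + y)‖ + ‖v x - v (x - y)‖) := by
  have : symDiff₂ v y x = (1 / 2 : ℝ) • ((v x - v (x + y)) + (v x - v (x - y))) := by
    rw [symDiff₂]; module
  rw [this, norm_smul, Real.norm_of_nonneg (by norm_num)]
  gcongr
  exact norm_add_le _ _

lemma norm_symDiff₂_le_of_holder (h : ∀ x x', ‖v x - v x'‖ ≤ M * ‖x - x'‖ ^ α) (y x : V) :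
    ‖symDiff₂ v y x‖ ≤ M * ‖y‖ ^ α := by
  have h1 := h x (x + y)
  have h2 := h x (x - y)
  simp only [sub_add_cancel_left, norm_neg, sub_sub_cancel] at h1 h2
  linarith [norm_symDiff₂_le v y x]

lemma norm_symDiff₂_le_of_bounded (h : ∀ x, ‖v x‖ ≤ M) (y x : V) :
    ‖symDiff₂ v y x‖ ≤ 2 * M := by
  linarith [norm_symDiff₂_le v y x, norm_sub_le (v x) (v (x + y)), norm_sub_le (v x) (v (x - y)),
    h x, h (x + y), h (x - y)]

lemma norm_symDiff₂_sub_le_of_holder (h : ∀ x x', ‖v x - v x'‖ ≤ M * ‖x - x'‖ ^ α) (y x x' : V) :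
    ‖symDiff₂ v y x - symDiff₂ v y x'‖ ≤ 2 * M * ‖x - x'‖ ^ α := by
  have e : symDiff₂ v y x - symDiff₂ v y x' = (v x - v x') -
      (1 / 2 : ℝ) • ((v (x + y) - v (x' + y)) + (v (x - y) - v (x' - y))) := by
    simp only [symDiff₂]; module
  have h1 := h (x + y) (x' + y)
  have h2 := h (x - y) (x' - y)
  simp only [add_sub_add_right_eq_sub, sub_sub_sub_cancel_right] at h1 h2
  rw [e]
  refine (norm_sub_le _ _).trans ?_
  rw [norm_smul, Real.norm_of_nonneg (by norm_num)]
  linarith [norm_add_le (v (x + y) - v (x' + y)) (v (x - y) - v (x' - y)), h x x']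

lemma hasFDerivAt_sub_translate (hv : Differentiable ℝ v) (y x : V) :
    HasFDerivAt (fun x => v x - v (x - y)) (fderiv ℝ v x - fderiv ℝ v (x - y)) x :=
  (hv x).hasFDerivAt.sub ((hasFDerivAt_comp_sub y).2 (hv (x - y)).hasFDerivAt)

lemma symDiff₂_eq_sub_translate (v : V → F) (y x : V) :
    symDiff₂ v y x = (-(1 / 2) : ℝ) •
      ((fun x => v x - v (x - y)) (x + y) - (fun x => v x - v (x - y)) x) := by
  simp only [symDiff₂, add_sub_cancel_right]; module

/-- A second difference is a first difference of `x ↦ v x - v (x - y)`, whose derivative is at most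
`M * ‖y‖ ^ α`; the mean value inequality supplies the other `‖y‖`. -/
lemma norm_symDiff₂_le_of_fderiv_holder (hM : 0 ≤ M) (hv : Differentiable ℝ v)
    (h : ∀ x x', ‖fderiv ℝ v x - fderiv ℝ v x'‖ ≤ M * ‖x - x'‖ ^ α) (y x : V) :
    ‖symDiff₂ v y x‖ ≤ M * (‖y‖ ^ α * ‖y‖) := by
  have hd := hasFDerivAt_sub_translate hv y
  have := norm_sub_le_of_norm_fderiv_le (M := M * ‖y‖ ^ α) (fun x => (hd x).differentiableAt)
    (fun x => by rw [(hd x).fderiv]; simpa using h x (x - y)) (x + y) x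
  rw [symDiff₂_eq_sub_translate, norm_smul]
  rw [add_sub_cancel_left] at this
  norm_num at this ⊢
  have h0 : 0 ≤ M * (‖y‖ ^ α * ‖y‖) := by positivity
  linarith

end DifferenceBounds

/-! ### Second differences against the two weights of the theorem -/

section WeightBounds

variable {V F : Type*} [NormedAddCommGroup V] [InnerProductSpace ℝ V] [FiniteDimensional ℝ V]
  [MeasurableSpace V] [BorelSpace V]
  [NormedAddCommGroup F] [NormedSpace ℝ F] {v : V → F} {M α : ℝ}

lemma le_mul_diffWeight {t a b r : ℝ} (hM : 0 ≤ M) {y : V} (h1 : t ≤ M * (‖y‖ ^ a * ‖y‖ ^ b))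
    (h2 : t ≤ M * (‖y‖ ^ a * r ^ b)) : t ≤ M * diffWeight a b r y := by
  rw [diffWeight, mul_min_of_nonneg _ _ (by positivity), mul_min_of_nonneg _ _ hM]
  exact le_min h1 h2

lemma norm_symDiff₂_le_diffWeight_zero (hM : 0 ≤ M) (hb : ∀ x, ‖v x‖ ≤ M)
    (h : ∀ x x', ‖v x - v x'‖ ≤ M * ‖x - x'‖ ^ α) (x y : V) :
    ‖symDiff₂ v y x‖ ≤ 2 * M * diffWeight 0 α 1 y := by
  refine le_mul_diffWeight (by positivity) ?_ ?_
  · have h1 := norm_symDiff₂_le_of_holder h y x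
    have h0 : 0 ≤ M * ‖y‖ ^ α := by positivity
    rw [Real.rpow_zero, one_mul]; linarith
  · simpa using norm_symDiff₂_le_of_bounded hb y x

lemma norm_symDiff₂_sub_le_diffWeight_zero (hM : 0 ≤ M)
    (h : ∀ x x', ‖v x - v x'‖ ≤ M * ‖x - x'‖ ^ α) (x x' y : V) :
    ‖symDiff₂ v y x - symDiff₂ v y x'‖ ≤ 2 * M * diffWeight 0 α ‖x - x'‖ y := by
  refine le_mul_diffWeight (by positivity) ?_ ?_
  · have h1 := norm_symDiff₂_le_of_holder h y x
    have h2 := norm_symDiff₂_le_of_holder h y x'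
    rw [Real.rpow_zero, one_mul]
    linarith [norm_sub_le (symDiff₂ v y x) (symDiff₂ v y x')]
  · simpa using norm_symDiff₂_sub_le_of_holder h y x x'

lemma norm_symDiff₂_le_diffWeight_one (hM : 0 ≤ M) (hv : Differentiable ℝ v)
    (h : ∀ x x', ‖v x - v x'‖ ≤ M * ‖x - x'‖ ^ α)
    (h' : ∀ x x', ‖fderiv ℝ v x - fderiv ℝ v x'‖ ≤ M * ‖x - x'‖ ^ α) (x y : V) :
    ‖symDiff₂ v y x‖ ≤ 2 * M * diffWeight α 1 1 y := by
  have h1 := norm_symDiff₂_le_of_fderiv_holder hM hv h' y x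
  have h2 := norm_symDiff₂_le_of_holder h y x
  have h3 := (norm_nonneg _).trans h1
  have h4 := (norm_nonneg _).trans h2
  refine le_mul_diffWeight (by positivity) ?_ ?_
  · rw [Real.rpow_one]; linarith
  · rw [Real.one_rpow, mul_one]; linarith

/-- The bound with `‖y‖` estimates the two terms separately; the bound with `‖x - x'‖` is the mean
value inequality for `symDiff₂ v y`, whose derivative is a second difference of `fderiv ℝ v`. -/
lemma norm_symDiff₂_sub_le_diffWeight_one (hM : 0 ≤ M) (hv : Differentiable ℝ v)
    (h' : ∀ x x', ‖fderiv ℝ v x - fderiv ℝ v x'‖ ≤ M * ‖x - x'‖ ^ α) (x x' y : V) :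
    ‖symDiff₂ v y x - symDiff₂ v y x'‖ ≤ 2 * M * diffWeight α 1 ‖x - x'‖ y := by
  refine le_mul_diffWeight (by positivity) ?_ ?_
  · have h1 := norm_symDiff₂_le_of_fderiv_holder hM hv h' y x
    have h2 := norm_symDiff₂_le_of_fderiv_holder hM hv h' y x'
    rw [Real.rpow_one]
    linarith [norm_sub_le (symDiff₂ v y x) (symDiff₂ v y x')]
  · have hd := hasFDerivAt_symDiff₂ hv y
    have := norm_sub_le_of_norm_fderiv_le (M := M * ‖y‖ ^ α) (fun x => (hd x).differentiableAt)
      (fun x => by rw [(hd x).fderiv]; exact norm_symDiff₂_le_of_holder h' y x) x x'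
    have h0 : 0 ≤ M * ‖y‖ ^ α * ‖x - x'‖ := by positivity
    rw [Real.rpow_one]
    linarith

end WeightBounds

/-! ### Derivatives of the hypersingular integral -/

section Regularity

variable {V F : Type*} [NormedAddCommGroup V] [InnerProductSpace ℝ V] [FiniteDimensional ℝ V]
  [MeasurableSpace V] [BorelSpace V]
  [NormedAddCommGroup F] [NormedSpace ℝ F] {u : V → F} {M α : ℝ} {k : ℕ}

/-- Linear isometries between normed spaces, with the instances derived from the norms. -/
abbrev NormedIsometryEquiv (F G : Type*) [NormedAddCommGroup F] [NormedSpace ℝ F]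
    [NormedAddCommGroup G] [NormedSpace ℝ G] := F ≃ₗᵢ[ℝ] G

/-- Currying of the first variable of a multilinear map in `j + 1` identical variables. -/
def curryFirst (V F : Type*) [NormedAddCommGroup V] [NormedSpace ℝ V]
    [NormedAddCommGroup F] [NormedSpace ℝ F] (j : ℕ) :
    NormedIsometryEquiv (V [×(j + 1)]→L[ℝ] F) (V →L[ℝ] (V [×j]→L[ℝ] F)) :=
  continuousMultilinearCurryLeftEquiv ℝ (fun _ : Fin (j + 1) => V) F

lemma iteratedFDeriv_succ_eq_curryFirst (u : V → F) (j : ℕ) :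
    iteratedFDeriv ℝ (j + 1) u = (curryFirst V F j).symm ∘ fderiv ℝ (iteratedFDeriv ℝ j u) :=
  iteratedFDeriv_succ_eq_comp_left

lemma fderiv_iteratedFDeriv_eq (u : V → F) (j : ℕ) :
    fderiv ℝ (iteratedFDeriv ℝ j u) =
      curryFirst V F j ∘
        iteratedFDeriv ℝ (j + 1) u := by
  ext1 x
  simp [iteratedFDeriv_succ_eq_curryFirst]

lemma contDiff_one_iteratedFDeriv (hu : ContDiff ℝ k u) {j : ℕ} (hj : j < k) :
    ContDiff ℝ 1 (iteratedFDeriv ℝ j u) :=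
  hu.iteratedFDeriv_right (by norm_cast; omega)

lemma norm_iteratedFDeriv_sub_le (hα0 : 0 ≤ α) (hα1 : α ≤ 1) (hM : 0 ≤ M) (hu : ContDiff ℝ k u)
    (hb : ∀ j ≤ k, ∀ x, ‖iteratedFDeriv ℝ j u x‖ ≤ M)
    (hh : ∀ x x', ‖iteratedFDeriv ℝ k u x - iteratedFDeriv ℝ k u x'‖ ≤ M * ‖x - x'‖ ^ α)
    {j : ℕ} (hj : j ≤ k) (x x' : V) :
    ‖iteratedFDeriv ℝ j u x - iteratedFDeriv ℝ j u x'‖ ≤ 2 * M * ‖x - x'‖ ^ α := by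
  rcases hj.eq_or_lt with rfl | hj'
  · have h0 : 0 ≤ M * ‖x - x'‖ ^ α := by positivity
    linarith [hh x x']
  · refine norm_sub_le_rpow_of_bounded_of_lipschitz hα0 hα1 hM (hb j hj) (fun x x' => ?_) x x'
    refine norm_sub_le_of_norm_fderiv_le
      ((contDiff_one_iteratedFDeriv hu hj').differentiable one_ne_zero) (fun x => ?_) x x'
    rw [norm_fderiv_iteratedFDeriv]
    exact hb _ hj' x

lemma norm_fderiv_iteratedFDeriv_sub (u : V → F) (j : ℕ) (x x' : V) :
    ‖fderiv ℝ (iteratedFDeriv ℝ j u) x - fderiv ℝ (iteratedFDeriv ℝ j u) x'‖ =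
      ‖iteratedFDeriv ℝ (j + 1) u x - iteratedFDeriv ℝ (j + 1) u x'‖ := by
  rw [fderiv_iteratedFDeriv_eq, Function.comp_apply, Function.comp_apply,
    ← LinearIsometryEquiv.map_sub, LinearIsometryEquiv.norm_map]

lemma hypersingular_fderiv_iteratedFDeriv (s : ℝ) (u : V → F) (j : ℕ) :
    hypersingular s (fderiv ℝ (iteratedFDeriv ℝ j u)) =
      curryFirst V F j ∘
        hypersingular s (iteratedFDeriv ℝ (j + 1) u) := by
  rw [fderiv_iteratedFDeriv_eq]
  exact hypersingular_comp_linearIsometryEquiv (G := V →L[ℝ] (V [×j]→L[ℝ] F)) s (curryFirst V F j) _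

lemma hasFDerivAt_hypersingular_iteratedFDeriv [Nontrivial V] {s a b : ℝ} (has : a < 2 * s)
    (hsab : 2 * s < a + b) (hu : ContDiff ℝ k u)
    (h : ∀ j ≤ k, ∀ x y, ‖symDiff₂ (iteratedFDeriv ℝ j u) y x‖ ≤ M * diffWeight a b 1 y)
    {j : ℕ} (hj : j < k) (x : V) :
    HasFDerivAt (hypersingular s (iteratedFDeriv ℝ j u))
      (hypersingular s (fderiv ℝ (iteratedFDeriv ℝ j u)) x) x := by
  refine hasFDerivAt_hypersingular has hsab (contDiff_one_iteratedFDeriv hu hj) (h j hj.le)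
    (M' := M) (fun x y => ?_) x
  rw [fderiv_iteratedFDeriv_eq]
  exact (norm_symDiff₂_comp_linearIsometryEquiv (G := V →L[ℝ] (V [×j]→L[ℝ] F))
    (curryFirst V F j) _ y x).trans_le (h (j + 1) hj x y)

/-- Induction on the order: each step differentiates once under the integral and passes through the
currying isometry, which commutes with `hypersingular`. -/
lemma iteratedFDeriv_hypersingular [Nontrivial V] {s a b : ℝ} (has : a < 2 * s)
    (hsab : 2 * s < a + b) (hu : ContDiff ℝ k u)
    (h : ∀ j ≤ k, ∀ x y, ‖symDiff₂ (iteratedFDeriv ℝ j u) y x‖ ≤ M * diffWeight a b 1 y)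
    {j : ℕ} (hj : j ≤ k) :
    iteratedFDeriv ℝ j (hypersingular s u) = hypersingular s (iteratedFDeriv ℝ j u) := by
  induction j with
  | zero =>
    rw [iteratedFDeriv_zero_eq_comp, iteratedFDeriv_zero_eq_comp]
    exact (hypersingular_comp_linearIsometryEquiv s
      (continuousMultilinearCurryFin0 ℝ V F).symm u).symm
  | succ j ih =>
    rw [iteratedFDeriv_succ_eq_curryFirst, ih (by omega)]
    ext1 x
    rw [Function.comp_apply,
      (hasFDerivAt_hypersingular_iteratedFDeriv has hsab hu h hj x).fderiv,
      hypersingular_fderiv_iteratedFDeriv, Function.comp_apply,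
      LinearIsometryEquiv.symm_apply_apply]

lemma contDiff_hypersingular [Nontrivial V] {s a b : ℝ} (has : a < 2 * s)
    (hsab : 2 * s < a + b) (hu : ContDiff ℝ k u)
    (h : ∀ j ≤ k, ∀ x y, ‖symDiff₂ (iteratedFDeriv ℝ j u) y x‖ ≤ M * diffWeight a b 1 y) :
    ContDiff ℝ k (hypersingular s u) := by
  refine (contDiff_iff_continuous_differentiable (n := (k : ℕ∞))).2
    ⟨fun j hj => ?_, fun j hj => ?_⟩
  · have hj : j ≤ k := by exact_mod_cast hj
    rw [iteratedFDeriv_hypersingular has hsab hu h hj]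
    exact continuous_hypersingular has hsab (hu.continuous_iteratedFDeriv (by exact_mod_cast hj))
      (h j hj)
  · have hj : j < k := by exact_mod_cast hj
    rw [iteratedFDeriv_hypersingular has hsab hu h hj.le]
    exact fun x =>
      (hasFDerivAt_hypersingular_iteratedFDeriv has hsab hu h hj x).differentiableAt

end Regularity

/-! ### Translation between the Hölder norm and pointwise bounds -/

section HolderSpace

variable {n k : ℕ} {α : ℝ} {u : EuclideanSpace ℝ (Fin n) → ℂ}

lemma MemHolderSpace.norm_iteratedFDeriv_le (hu : MemHolderSpace k α u) {j : ℕ} (hj : j ≤ k)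
    (x : EuclideanSpace ℝ (Fin n)) :
    ‖iteratedFDeriv ℝ j u x‖ ≤ (holderSpaceNorm k α u).toNNReal := by
  have h : ‖iteratedFDeriv ℝ j u x‖ₑ ≤ holderSpaceNorm k α u := by
    refine (le_iSup (fun x => ‖iteratedFDeriv ℝ j u x‖ₑ) x).trans (le_trans ?_ le_self_add)
    exact Finset.single_le_sum (f := fun j => ⨆ x, ‖iteratedFDeriv ℝ j u x‖ₑ)
      (fun _ _ => zero_le) (Finset.mem_range.2 (by omega))
  rw [← ENNReal.coe_toNNReal hu.2.ne, enorm_le_coe] at h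
  exact_mod_cast h

lemma MemHolderSpace.norm_iteratedFDeriv_sub_le (hα : 0 < α) (hu : MemHolderSpace k α u)
    (x x' : EuclideanSpace ℝ (Fin n)) :
    ‖iteratedFDeriv ℝ k u x - iteratedFDeriv ℝ k u x'‖ ≤
      (holderSpaceNorm k α u).toNNReal * ‖x - x'‖ ^ α := by
  have hlt : eHolderNorm α.toNNReal (iteratedFDeriv ℝ k u) < ∞ :=
    lt_of_le_of_lt le_add_self hu.2
  have hm := eHolderNorm_lt_top.1 hlt
  have h1 := hm.holderWith.dist_le x x'
  rw [dist_eq_norm, dist_eq_norm, Real.coe_toNNReal α hα.le] at h1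
  refine h1.trans ?_
  gcongr
  exact_mod_cast ENNReal.toNNReal_mono hu.2.ne le_add_self

/-- The factor `k + 2` counts the `k + 1` sup norms and the one seminorm. -/
lemma holderSpaceNorm_le (hα : 0 < α) {M : ℝ≥0}
    (hb : ∀ j ≤ k, ∀ x, ‖iteratedFDeriv ℝ j u x‖ ≤ M)
    (hh : ∀ x x', ‖iteratedFDeriv ℝ k u x - iteratedFDeriv ℝ k u x'‖ ≤ M * ‖x - x'‖ ^ α) :
    holderSpaceNorm k α u ≤ ((k + 2 : ℝ≥0) * M : ℝ≥0) := by
  have h1 : ∑ j ∈ Finset.range (k + 1), ⨆ x, ‖iteratedFDeriv ℝ j u x‖ₑ ≤ (k + 1) * M := by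
    refine (Finset.sum_le_card_nsmul _ _ (M : ℝ≥0∞) fun j hj => iSup_le fun x => ?_).trans_eq ?_
    · rw [enorm_le_coe]
      exact_mod_cast hb j (by have := Finset.mem_range.1 hj; omega) x
    · simp
  have h2 : eHolderNorm α.toNNReal (iteratedFDeriv ℝ k u) ≤ M := by
    refine HolderWith.eHolderNorm_le fun x x' => ?_
    rw [edist_eq_enorm_sub, edist_eq_enorm_sub, Real.coe_toNNReal α hα.le,
      ← ofReal_norm, ← ofReal_norm,
      ENNReal.ofReal_rpow_of_nonneg (norm_nonneg _) hα.le, ← ENNReal.ofReal_coe_nnreal,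
      ← ENNReal.ofReal_mul M.coe_nonneg]
    exact ENNReal.ofReal_le_ofReal (hh x x')
  refine (add_le_add h1 h2).trans_eq ?_
  push_cast
  ring

end HolderSpace

/-! ### The symbol as an integral of `1 - cos` -/

section Symbol

variable {V : Type*} [NormedAddCommGroup V] [InnerProductSpace ℝ V] [FiniteDimensional ℝ V]
  [MeasurableSpace V] [BorelSpace V]

open Real in
lemma norm_one_sub_cos_le_diffWeight (y ξ : V) :
    ‖1 - cos (2 * π * inner ℝ y ξ)‖ ≤ (2 + 2 * π ^ 2 * ‖ξ‖ ^ 2) * diffWeight 0 2 1 y := by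
  have h0 : 0 ≤ 1 - cos (2 * π * inner ℝ y ξ) := by linarith [cos_le_one (2 * π * inner ℝ y ξ)]
  rw [norm_of_nonneg h0]
  have hp : 0 ≤ 2 * π ^ 2 * ‖ξ‖ ^ 2 := by positivity
  refine le_mul_diffWeight (by positivity) ?_ ?_
  · have h1 := one_sub_sq_div_two_le_cos (x := 2 * π * inner ℝ y ξ)
    have h2 : (inner ℝ y ξ) ^ 2 ≤ (‖y‖ * ‖ξ‖) ^ 2 :=
      sq_le_sq' (neg_le_of_abs_le (abs_real_inner_le_norm y ξ)) (real_inner_le_norm y ξ)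
    rw [rpow_zero, one_mul, rpow_two]
    have h3 := mul_le_mul_of_nonneg_left h2 (by positivity : 0 ≤ 2 * π ^ 2)
    nlinarith [sq_nonneg ‖y‖]
  · rw [rpow_zero, one_rpow]
    linarith [neg_one_le_cos (2 * π * inner ℝ y ξ)]

lemma integrable_fracKernel_mul_one_sub_cos [Nontrivial V] {s : ℝ} (hs0 : 0 < s) (hs1 : s < 1)
    (ξ : V) :
    Integrable (fun y : V => fracKernel s y * (1 - Real.cos (2 * Real.pi * inner ℝ y ξ))) := by
  refine ((integrable_fracKernel_mul_diffWeight (V := V) (s := s) (a := 0) (b := 2) (by linarith)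
    (by linarith)).const_mul (2 + 2 * Real.pi ^ 2 * ‖ξ‖ ^ 2)).mono' ?_ (ae_of_all _ fun y => ?_)
  · refine ((measurable_fracKernel s).mul ?_).aestronglyMeasurable
    fun_prop
  · rw [← smul_eq_mul]
    exact (norm_fracKernel_smul_le (norm_one_sub_cos_le_diffWeight y ξ)).trans_eq (by ring)

/-- The integral representation of the symbol of the fractional Laplacian, up to a factor. -/
def fracSymbol (s : ℝ) (ξ : V) : ℝ :=
  ∫ y : V, fracKernel s y * (1 - Real.cos (2 * Real.pi * inner ℝ y ξ))

/-- The reflection in the hyperplane orthogonal to `ξ - η` takes `ξ` to `η` and preserves norms and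
Lebesgue measure. -/
lemma fracSymbol_congr_norm (s : ℝ) {ξ η : V} (h : ‖ξ‖ = ‖η‖) :
    fracSymbol s ξ = fracSymbol s η := by
  set R := (Submodule.span ℝ {ξ - η})ᗮ.reflection
  have hR : R ξ = η := Submodule.reflection_sub h
  rw [fracSymbol, fracSymbol, ← R.measurePreserving.integral_comp
    R.toHomeomorph.measurableEmbedding
    (fun y => fracKernel s y * (1 - Real.cos (2 * Real.pi * inner ℝ y η)))]
  refine integral_congr_ae (ae_of_all _ fun y => ?_)
  simp only [fracKernel, R.norm_map]
  rw [← hR, R.inner_map_map]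

lemma fracSymbol_smul (s : ℝ) {r : ℝ} (hr : 0 < r) (ξ : V) :
    fracSymbol s (r • ξ) = r ^ (2 * s) * fracSymbol s ξ := by
  have h := Measure.integral_comp_smul (volume : Measure V)
    (fun y : V => fracKernel s y * (1 - Real.cos (2 * Real.pi * inner ℝ y ξ))) r
  simp only [fracKernel_smul s hr, real_inner_smul_left, mul_assoc, integral_const_mul,
    smul_eq_mul] at h
  rw [abs_of_pos (by positivity)] at h
  simp only [fracSymbol, real_inner_smul_right, mul_assoc]
  have e : r ^ (-((Module.finrank ℝ V : ℝ) + 2 * s)) =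
      (r ^ Module.finrank ℝ V)⁻¹ * (r ^ (2 * s))⁻¹ := by
    rw [neg_add, Real.rpow_add hr, Real.rpow_neg hr.le, Real.rpow_neg hr.le, Real.rpow_natCast]
  rw [e, mul_assoc] at h
  have h' := mul_left_cancel₀ (by positivity) h
  rw [← h', mul_inv_cancel_left₀ (by positivity)]

/-- The integrand is nonnegative, and positive on the open set where the cosine is negative; that
set is nonempty and misses the origin. -/
lemma fracSymbol_pos [Nontrivial V] {s : ℝ} (hs0 : 0 < s) (hs1 : s < 1) {ξ : V} (hξ : ξ ≠ 0) :
    0 < fracSymbol s ξ := by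
  have hnn : ∀ y : V, 0 ≤ fracKernel s y * (1 - Real.cos (2 * Real.pi * inner ℝ y ξ)) := fun y =>
    mul_nonneg (fracKernel_nonneg s y) (by linarith [Real.cos_le_one (2 * Real.pi * inner ℝ y ξ)])
  rw [fracSymbol, integral_pos_iff_support_of_nonneg hnn
    (integrable_fracKernel_mul_one_sub_cos hs0 hs1 ξ)]
  set U : Set V := {y | Real.cos (2 * Real.pi * inner ℝ y ξ) < 0}
  have hU : IsOpen U := isOpen_lt (by fun_prop) continuous_const
  have hne : U.Nonempty := by
    -- This point makes the argument of the cosine equal to `π`.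
    refine ⟨((2 * ‖ξ‖ ^ 2)⁻¹ : ℝ) • ξ, ?_⟩
    have : ‖ξ‖ ≠ 0 := norm_ne_zero_iff.2 hξ
    have e : 2 * Real.pi * inner ℝ (((2 * ‖ξ‖ ^ 2)⁻¹ : ℝ) • ξ) ξ = Real.pi := by
      rw [real_inner_smul_left, real_inner_self_eq_norm_sq]
      field_simp
    show Real.cos _ < 0
    rw [e, Real.cos_pi]
    norm_num
  refine (hU.measure_pos volume hne).trans_le (measure_mono fun y hy => ?_)
  have hy : Real.cos (2 * Real.pi * inner ℝ y ξ) < 0 := hy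
  have hy0 : y ≠ 0 := by
    rintro rfl
    norm_num at hy
  have : 0 < fracKernel s y := Real.rpow_pos_of_pos (norm_pos_iff.2 hy0) _
  exact (mul_pos this (by linarith)).ne'

/-- A radial function homogeneous of degree `2s` is determined by its value at a unit vector, and
positivity there allows division by it. -/
lemma exists_fracSymbol_eq [Nontrivial V] {s : ℝ} (hs0 : 0 < s) (hs1 : s < 1) :
    ∃ c : ℝ, 0 < c ∧ ∀ ξ : V, (2 * Real.pi * ‖ξ‖) ^ (2 * s) = c * fracSymbol s ξ := by
  obtain ⟨e, he⟩ := exists_norm_eq V zero_le_one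
  have he0 : e ≠ 0 := by rintro rfl; simp at he
  have hp := fracSymbol_pos hs0 hs1 he0
  refine ⟨(2 * Real.pi) ^ (2 * s) / fracSymbol s e, by positivity, fun ξ => ?_⟩
  rcases eq_or_ne ξ 0 with rfl | hξ
  · have : 2 * s ≠ 0 := by positivity
    simp [fracSymbol, Real.zero_rpow this]
  · have h1 : fracSymbol s ξ = ‖ξ‖ ^ (2 * s) * fracSymbol s e := by
      rw [← fracSymbol_smul s (norm_pos_iff.2 hξ)]
      exact fracSymbol_congr_norm s (by simp [norm_smul, he])
    rw [h1, Real.mul_rpow (by positivity) (norm_nonneg _)]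
    field_simp

end Symbol

/-! ### The Fourier multiplier equals the hypersingular integral -/

section Multiplier

lemma integral_sub_half_smul_add {X F : Type*} [MeasurableSpace X] {μ : Measure X}
    [NormedAddCommGroup F] [NormedSpace ℝ F] {f g h : X → F} (hf : Integrable f μ)
    (hg : Integrable g μ) (hh : Integrable h μ) :
    ∫ x, (f x - (1 / 2 : ℝ) • (g x + h x)) ∂μ =
      ∫ x, f x ∂μ - (1 / 2 : ℝ) • (∫ x, g x ∂μ + ∫ x, h x ∂μ) := by
  rw [integral_sub hf (g := fun x => (1 / 2 : ℝ) • (g x + h x)) ((hg.add hh).smul (1 / 2 : ℝ)),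
    integral_smul, integral_add hg hh]

variable {V : Type*} [NormedAddCommGroup V] [InnerProductSpace ℝ V] [FiniteDimensional ℝ V]
  [MeasurableSpace V] [BorelSpace V]

lemma integrable_exp_smul {f : V → ℂ} (hf : Integrable f) (x : V) :
    Integrable (fun ξ : V => Complex.exp (↑(2 * Real.pi * inner ℝ ξ x) * Complex.I) • f ξ) := by
  refine hf.mono ?_ (ae_of_all _ fun ξ => ?_)
  · exact (by fun_prop : Continuous fun ξ : V =>
      Complex.exp (↑(2 * Real.pi * inner ℝ ξ x) * Complex.I)).aestronglyMeasurable.smul hf.1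
  · rw [norm_smul, Complex.norm_exp_ofReal_mul_I, one_mul]

lemma symDiff₂_fourierInv {f : V → ℂ} (hf : Integrable f) (y x : V) :
    symDiff₂ (𝓕⁻ f) y x = ∫ ξ : V, (1 - Real.cos (2 * Real.pi * inner ℝ y ξ)) •
      (Complex.exp (↑(2 * Real.pi * inner ℝ ξ x) * Complex.I) • f ξ) := by
  simp only [symDiff₂, Real.fourierInv_eq']
  rw [← integral_sub_half_smul_add (integrable_exp_smul hf _) (integrable_exp_smul hf _)
    (integrable_exp_smul hf _)]
  refine integral_congr_ae (ae_of_all _ fun ξ => ?_)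
  have e1 : (↑(2 * Real.pi * inner ℝ ξ (x + y)) * Complex.I : ℂ) =
      ↑(2 * Real.pi * inner ℝ ξ x) * Complex.I + ↑(2 * Real.pi * inner ℝ y ξ) * Complex.I := by
    rw [inner_add_right, real_inner_comm ξ y]; push_cast; ring
  have e2 : (↑(2 * Real.pi * inner ℝ ξ (x - y)) * Complex.I : ℂ) =
      ↑(2 * Real.pi * inner ℝ ξ x) * Complex.I + -↑(2 * Real.pi * inner ℝ y ξ) * Complex.I := by
    rw [inner_sub_right, real_inner_comm ξ y]; push_cast; ring
  simp only [e1, e2, Complex.exp_add, Complex.real_smul, smul_eq_mul, Complex.ofReal_sub,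
    Complex.ofReal_cos, Complex.cos]
  push_cast
  ring

/-- Fubini for `H ξ y`: integrating in `y` first produces the symbol, integrating in `ξ` first
produces the second difference of `φ` by Fourier inversion. -/
lemma fourierInv_fracMultiplier [Nontrivial V] {s c : ℝ} (hs0 : 0 < s) (hs1 : s < 1)
    (hc : ∀ ξ : V, (2 * Real.pi * ‖ξ‖) ^ (2 * s) = c * fracSymbol s ξ) (φ : 𝓢(V, ℂ)) (x : V) :
    𝓕⁻ (fun ξ : V => ((2 * Real.pi * ‖ξ‖) ^ (2 * s) : ℝ) • 𝓕 (φ : V → ℂ) ξ) x =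
      c • hypersingular s φ x := by
  have hφ : Integrable (𝓕 (φ : V → ℂ)) := by
    rw [← SchwartzMap.fourier_coe]; exact (𝓕 φ).integrable
  have hinv : 𝓕⁻ (𝓕 (φ : V → ℂ)) = φ :=
    φ.continuous.fourierInv_fourier_eq φ.integrable hφ
  set f := 𝓕 (φ : V → ℂ) with hf
  set H : V → V → ℂ := fun ξ y =>
    (fracKernel s y * (1 - Real.cos (2 * Real.pi * inner ℝ y ξ))) •
      (Complex.exp (↑(2 * Real.pi * inner ℝ ξ x) * Complex.I) • f ξ) with hH
  -- The `ξ`-factor of the dominating function; the quadratic growth comes from the bound on `1 -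
  -- cos` and is absorbed by the decay of the Fourier transform.
  have hw : Integrable (fun ξ : V => (2 + 2 * Real.pi ^ 2 * ‖ξ‖ ^ 2) * ‖f ξ‖) := by
    have h2 := (𝓕 φ).integrable_pow_mul volume 2
    rw [SchwartzMap.fourier_coe, ← hf] at h2
    refine ((hφ.norm.const_mul 2).add (h2.const_mul (2 * Real.pi ^ 2))).congr
      (ae_of_all _ fun ξ => ?_)
    simp only [Pi.add_apply]
    ring
  have hfm : Continuous f := by
    rw [hf, ← SchwartzMap.fourier_coe]; exact (𝓕 φ).continuous
  have hint : Integrable (Function.uncurry H) (volume.prod volume) := by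
    refine (hw.mul_prod (integrable_fracKernel_mul_diffWeight (V := V) (s := s) (a := 0) (b := 2)
      (by linarith) (by linarith))).mono' ?_ (ae_of_all _ fun p => ?_)
    · have h1 : Measurable fun p : V × V =>
          fracKernel s p.2 * (1 - Real.cos (2 * Real.pi * inner ℝ p.2 p.1)) :=
        ((measurable_fracKernel (V := V) s).comp measurable_snd).mul
          (Continuous.measurable (by fun_prop))
      have h2 : Continuous fun p : V × V =>
          Complex.exp (↑(2 * Real.pi * inner ℝ p.1 x) * Complex.I) • f p.1 := by fun_prop
      exact h1.aestronglyMeasurable.smul h2.aestronglyMeasurable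
    · obtain ⟨ξ, y⟩ := p
      simp only [Function.uncurry_apply_pair, hH]
      rw [norm_smul, norm_smul, Complex.norm_exp_ofReal_mul_I, one_mul, ← smul_eq_mul]
      have := mul_le_mul_of_nonneg_right (norm_fracKernel_smul_le (s := s) (y := y)
        (norm_one_sub_cos_le_diffWeight y ξ)) (norm_nonneg (f ξ))
      refine this.trans_eq ?_
      ring
  have hswap := integral_integral_swap hint
  have hL : ∀ ξ, ∫ y, H ξ y = fracSymbol s ξ •
      (Complex.exp (↑(2 * Real.pi * inner ℝ ξ x) * Complex.I) • f ξ) := fun ξ => by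
    simp only [hH]
    rw [integral_smul_const, fracSymbol]
  have hR : ∀ y, ∫ ξ, H ξ y = fracKernel s y • symDiff₂ φ y x := fun y => by
    simp only [hH, mul_smul]
    rw [integral_smul, ← hinv, symDiff₂_fourierInv hφ]
  simp only [hL, hR] at hswap
  rw [hypersingular, ← hswap, Real.fourierInv_eq', ← integral_smul]
  refine integral_congr_ae (ae_of_all _ fun ξ => ?_)
  simp only [hc, Complex.real_smul, smul_eq_mul]
  push_cast
  ring

end Multiplier

/-! ### Symmetry of the hypersingular integral under the pairing -/

section Duality

variable {V : Type*} [NormedAddCommGroup V] [InnerProductSpace ℝ V] [FiniteDimensional ℝ V]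
  [MeasurableSpace V] [BorelSpace V] {F : Type*} [NormedAddCommGroup F] [NormedSpace ℝ F]
  [CompleteSpace F]

lemma enorm_sub_le_lintegral_fderiv {v : V → F} (hv : ContDiff ℝ 1 v) (x y : V) :
    ‖v (x + y) - v x‖ₑ ≤ ∫⁻ t in Set.Icc (0 : ℝ) 1, ‖fderiv ℝ v (x + t • y)‖ₑ * ‖y‖ₑ := by
  have hd : ∀ t ∈ Set.uIcc (0 : ℝ) 1,
      HasDerivAt (fun t : ℝ => v (x + t • y)) (fderiv ℝ v (x + t • y) y) t := fun t _ => by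
    have h1 : HasDerivAt (fun t : ℝ => x + t • y) y t := by
      simpa using ((hasDerivAt_id t).smul_const y).const_add x
    exact (hv.differentiable one_ne_zero _).hasFDerivAt.comp_hasDerivAt t h1
  have hc : Continuous fun t : ℝ => fderiv ℝ v (x + t • y) y :=
    ((hv.continuous_fderiv one_ne_zero).comp (by fun_prop)).clm_apply continuous_const
  have := intervalIntegral.integral_eq_sub_of_hasDerivAt hd (hc.intervalIntegrable 0 1)
  simp only [one_smul, zero_smul, add_zero] at this
  rw [← this, intervalIntegral.integral_of_le zero_le_one, ← integral_Icc_eq_integral_Ioc]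
  refine (enorm_integral_le_lintegral_enorm _).trans (lintegral_mono fun t => ?_)
  exact ContinuousLinearMap.le_opENorm _ _

/-- Integrate the fundamental theorem of calculus over `x`: Tonelli and translation invariance
remove the dependence on the point of the segment. -/
lemma lintegral_enorm_translate_sub_le {v : V → F} (hv : ContDiff ℝ 1 v) (y : V) :
    ∫⁻ x, ‖v (x + y) - v x‖ₑ ≤ (∫⁻ x, ‖fderiv ℝ v x‖ₑ) * ‖y‖ₑ := by
  have hc := hv.continuous_fderiv one_ne_zero
  calc ∫⁻ x, ‖v (x + y) - v x‖ₑ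
      ≤ ∫⁻ x, ∫⁻ t in Set.Icc (0 : ℝ) 1, ‖fderiv ℝ v (x + t • y)‖ₑ * ‖y‖ₑ :=
        lintegral_mono fun x => enorm_sub_le_lintegral_fderiv hv x y
    _ = ∫⁻ t in Set.Icc (0 : ℝ) 1, ∫⁻ x, ‖fderiv ℝ v (x + t • y)‖ₑ * ‖y‖ₑ := by
        refine lintegral_lintegral_swap ?_
        refine AEMeasurable.mul_const ?_ _
        refine Measurable.aemeasurable (Continuous.measurable ?_)
        exact continuous_enorm.comp (hc.comp (by fun_prop))
    _ = ∫⁻ t in Set.Icc (0 : ℝ) 1, (∫⁻ x, ‖fderiv ℝ v x‖ₑ) * ‖y‖ₑ := by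
        refine lintegral_congr fun t => ?_
        rw [lintegral_mul_const' _ _ enorm_ne_top,
          lintegral_add_right_eq_self (fun x => ‖fderiv ℝ v x‖ₑ)]
    _ = _ := by simp

lemma lintegral_enorm_symDiff₂_le {v : V → F} (hv : ContDiff ℝ 2 v) (y : V) :
    ∫⁻ x, ‖symDiff₂ v y x‖ₑ ≤ (∫⁻ x, ‖fderiv ℝ (fderiv ℝ v) x‖ₑ) * ‖y‖ₑ * ‖y‖ₑ := by
  have hv1 : ContDiff ℝ 1 v := hv.of_le (by norm_num)
  have hv' : ContDiff ℝ 1 (fderiv ℝ v) := hv.fderiv_right (by norm_num)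
  have hw : ContDiff ℝ 1 (fun x => v x - v (x - y)) :=
    hv1.sub (hv1.comp (contDiff_id.sub contDiff_const))
  calc ∫⁻ x, ‖symDiff₂ v y x‖ₑ
      ≤ ∫⁻ x, ‖(fun x => v x - v (x - y)) (x + y) - (fun x => v x - v (x - y)) x‖ₑ := by
        refine lintegral_mono fun x => ?_
        rw [symDiff₂_eq_sub_translate, enorm_smul]
        refine mul_le_of_le_one_left zero_le ?_
        rw [← ofReal_norm, ENNReal.ofReal_le_one]
        norm_num
    _ ≤ (∫⁻ x, ‖fderiv ℝ (fun x => v x - v (x - y)) x‖ₑ) * ‖y‖ₑ :=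
        lintegral_enorm_translate_sub_le hw y
    _ = (∫⁻ x, ‖fderiv ℝ v (x + y) - fderiv ℝ v x‖ₑ) * ‖y‖ₑ := by
        rw [← lintegral_add_right_eq_self _ y]
        simp only [fun x => (hasFDerivAt_sub_translate (hv1.differentiable one_ne_zero) y x).fderiv,
          add_sub_cancel_right]
    _ ≤ _ := by gcongr; exact lintegral_enorm_translate_sub_le hv' y

/-- An `L¹` bound in `x` is what pairing with a merely bounded `u` requires. Small `y` uses two
derivatives of `φ`, large `y` the triangle inequality. -/
lemma exists_integral_norm_symDiff₂_le (φ : 𝓢(V, F)) :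
    ∃ M : ℝ, ∀ y : V, ∫ x, ‖symDiff₂ φ y x‖ ≤ M * diffWeight 0 2 1 y := by
  set ψ := SchwartzMap.fderivCLM ℝ V (V →L[ℝ] F) (SchwartzMap.fderivCLM ℝ V F φ)
  set A := ∫ x, ‖ψ x‖
  set B := ∫ x, ‖φ x‖
  have hA : 0 ≤ A := integral_nonneg fun _ => norm_nonneg _
  have hB : 0 ≤ B := integral_nonneg fun _ => norm_nonneg _
  refine ⟨A + 2 * B, fun y => le_mul_diffWeight (by positivity) ?_ ?_⟩
  · have h := lintegral_enorm_symDiff₂_le (φ.smooth 2) y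
    have hA' : ∫⁻ x, ‖fderiv ℝ (fderiv ℝ φ) x‖ₑ = ENNReal.ofReal A :=
      (ofReal_integral_norm_eq_lintegral_enorm ψ.integrable).symm
    rw [hA', ← ofReal_norm, ← ENNReal.ofReal_mul hA,
      ← ENNReal.ofReal_mul (by positivity)] at h
    rw [integral_norm_eq_lintegral_enorm (continuous_symDiff₂ φ.continuous y).aestronglyMeasurable]
    refine (ENNReal.toReal_le_of_le_ofReal (by positivity) h).trans ?_
    rw [Real.rpow_zero, Real.rpow_two]
    nlinarith [mul_nonneg hB (sq_nonneg ‖y‖)]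
  · have i1 : Integrable (fun x => ‖φ (x + y)‖) := φ.integrable.norm.comp_add_right y
    have i2 : Integrable (fun x => ‖φ (x - y)‖) := φ.integrable.norm.comp_sub_right y
    have h : ∫ x, ‖symDiff₂ φ y x‖ ≤ ∫ x, (‖φ x‖ + (1 / 2 : ℝ) * (‖φ (x + y)‖ + ‖φ (x - y)‖)) := by
      refine integral_mono_of_nonneg (ae_of_all _ fun _ => norm_nonneg _)
        (φ.integrable.norm.add ((i1.add i2).const_mul _)) (ae_of_all _ fun x => ?_)
      refine (norm_sub_le _ _).trans ?_
      rw [norm_smul, Real.norm_of_nonneg (by norm_num)]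
      have := norm_add_le (φ (x + y)) (φ (x - y))
      simp only
      linarith
    rw [integral_add φ.integrable.norm (g := fun x => (1 / 2 : ℝ) * (‖φ (x + y)‖ + ‖φ (x - y)‖))
      ((i1.add i2).const_mul _), integral_const_mul,
      integral_add i1 i2, integral_add_right_eq_self (fun x => ‖φ x‖),
      integral_sub_right_eq_self (fun x => ‖φ x‖)] at h
    simp only [Real.rpow_zero, Real.one_rpow]
    linarith

lemma integrable_symDiff₂ {v : V → F} (hv : Integrable v) (y : V) : Integrable (symDiff₂ v y) :=
  hv.sub (((hv.comp_add_right y).add (hv.comp_sub_right y)).smul (1 / 2 : ℝ))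

lemma integrable_prod_fracKernel_smul_symDiff₂ [Nontrivial V] {s : ℝ} (hs0 : 0 < s) (hs1 : s < 1)
    (φ : 𝓢(V, F)) :
    Integrable (fun p : V × V => fracKernel s p.2 • symDiff₂ φ p.2 p.1)
      (volume.prod volume) := by
  have hm : AEStronglyMeasurable (fun p : V × V => fracKernel s p.2 • symDiff₂ φ p.2 p.1)
      (volume.prod volume) :=
    ((measurable_fracKernel s).comp measurable_snd).aestronglyMeasurable.smul
      (continuous_symDiff₂_uncurry φ.continuous).aestronglyMeasurable
  obtain ⟨M, hM⟩ := exists_integral_norm_symDiff₂_le φ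
  refine (integrable_prod_iff' hm).2
    ⟨ae_of_all _ fun y => (integrable_symDiff₂ φ.integrable y).fun_smul (fracKernel s y), ?_⟩
  refine ((integrable_fracKernel_mul_diffWeight (V := V) (s := s) (a := 0) (b := 2)
    (by linarith) (by linarith)).const_mul M).mono' hm.norm.prod_swap.integral_prod_right' ?_
  refine ae_of_all _ fun y => ?_
  rw [Real.norm_of_nonneg (integral_nonneg fun _ => norm_nonneg _)]
  simp only [norm_smul, Real.norm_of_nonneg (fracKernel_nonneg s y)]
  rw [integral_const_mul]
  exact (mul_le_mul_of_nonneg_left (hM y) (fracKernel_nonneg s y)).trans_eq (by ring)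

/-- Translation invariance moves a shift by `y` off `u` as a shift by `-y` on `φ`, and the second
difference is even in `y`. -/
lemma integral_symDiff₂_mul {u φ : V → ℂ} {B : ℝ} (hu : Continuous u) (hB : ∀ x, ‖u x‖ ≤ B)
    (hφ : Integrable φ) (y : V) :
    ∫ x, symDiff₂ u y x * φ x = ∫ x, u x * symDiff₂ φ y x := by
  have hi : ∀ z : V, Integrable fun x => u (x + z) * φ x := fun z =>
    hφ.bdd_mul (c := B) (hu.comp (by fun_prop)).aestronglyMeasurable (ae_of_all _ fun x => hB _)
  have hi' : ∀ z : V, Integrable fun x => u x * φ (x + z) := fun z =>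
    (hφ.comp_add_right z).bdd_mul (c := B) hu.aestronglyMeasurable (ae_of_all _ fun x => hB _)
  have ht : ∀ z : V, ∫ x, u (x + z) * φ x = ∫ x, u x * φ (x + -z) := fun z => by
    rw [← integral_add_right_eq_self (fun x => u x * φ (x + -z)) z]
    simp
  have e1 : ∀ x, symDiff₂ u y x * φ x =
      u (x + 0) * φ x - (1 / 2 : ℝ) • (u (x + y) * φ x + u (x + -y) * φ x) := fun x => by
    simp only [symDiff₂, add_zero, ← sub_eq_add_neg, Complex.real_smul]; ring
  have e2 : ∀ x, u x * symDiff₂ φ y x =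
      u x * φ (x + -0) - (1 / 2 : ℝ) • (u x * φ (x + -y) + u x * φ (x + - -y)) := fun x => by
    simp only [symDiff₂, neg_zero, neg_neg, add_zero, ← sub_eq_add_neg, Complex.real_smul]; ring
  simp only [e1, e2]
  rw [integral_sub_half_smul_add (hi 0) (hi y) (hi (-y)),
    integral_sub_half_smul_add (hi' (-0)) (hi' (-y)) (hi' (- -y)), ht, ht, ht]

/-- Fubini on both sides reduces to fixed `y`. The left integrand is dominated through the pointwise
bound on `u`, the right one through the `L¹` bound on `φ`. -/
lemma integral_hypersingular_mul [Nontrivial V] {s a b M B : ℝ} (hs0 : 0 < s) (hs1 : s < 1)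
    (has : a < 2 * s) (hsab : 2 * s < a + b) {u : V → ℂ} (hu : Continuous u)
    (hB : ∀ x, ‖u x‖ ≤ B) (h : ∀ x y, ‖symDiff₂ u y x‖ ≤ M * diffWeight a b 1 y)
    (φ : 𝓢(V, ℂ)) :
    ∫ x, hypersingular s u x * φ x = ∫ x, u x * hypersingular s φ x := by
  have h1 : Integrable (Function.uncurry fun x y : V => (fracKernel s y • symDiff₂ u y x) * φ x)
      (volume.prod volume) := by
    refine (φ.integrable.norm.mul_prod
      ((integrable_fracKernel_mul_diffWeight (V := V) has hsab).const_mul M)).mono' ?_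
      (ae_of_all _ fun p => ?_)
    · refine AEStronglyMeasurable.mul ?_ ?_
      · exact ((measurable_fracKernel (V := V) s).comp measurable_snd).aestronglyMeasurable.smul
          (continuous_symDiff₂_uncurry hu).aestronglyMeasurable
      · exact (φ.continuous.comp continuous_fst).aestronglyMeasurable
    · simp only [Function.uncurry, norm_mul]
      have := mul_le_mul_of_nonneg_right (norm_fracKernel_smul_le (s := s) (y := p.2) (h p.1 p.2))
        (norm_nonneg (φ p.1))
      exact this.trans_eq (by ring)
  have h2 : Integrable (Function.uncurry fun x y : V => u x * (fracKernel s y • symDiff₂ φ y x))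
      (volume.prod volume) :=
    (integrable_prod_fracKernel_smul_symDiff₂ hs0 hs1 φ).bdd_mul (c := B)
      (hu.comp continuous_fst).aestronglyMeasurable (ae_of_all _ fun p => hB _)
  simp only [hypersingular, ← integral_mul_const, ← integral_const_mul]
  rw [integral_integral_swap h1, integral_integral_swap h2]
  refine integral_congr_ae (ae_of_all _ fun y => ?_)
  simp only [smul_mul_assoc, mul_smul_comm]
  rw [integral_smul, integral_smul, integral_symDiff₂_mul hu hB φ.integrable]

end Duality

/-! ### Identification of the fractional Laplacian and the estimates -/

section Main

variable {n k : ℕ} {s α : ℝ}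

lemma memLs_of_bounded (hs : 0 < s) {u : EuclideanSpace ℝ (Fin n) → ℂ} (hu : Continuous u)
    {B : ℝ} (hB : ∀ x, ‖u x‖ ≤ B) : MemLs s u := by
  set p : ℝ := (n : ℝ) + 2 * s
  have hp : 0 < p := by positivity
  have hI : Integrable fun x : EuclideanSpace ℝ (Fin n) => (1 + ‖x‖) ^ (-p) :=
    integrable_one_add_norm (by simp [p]; positivity)
  refine (hI.const_mul (2 ^ p * B)).mono' ?_ (ae_of_all _ fun x => ?_)
  · have : Measurable fun x : EuclideanSpace ℝ (Fin n) => (1 + ‖x‖ ^ p)⁻¹ := by fun_prop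
    exact this.aestronglyMeasurable.smul hu.aestronglyMeasurable
  · have hx := norm_nonneg x
    have h1 : (1 + ‖x‖) ^ p ≤ 2 ^ p * (1 + ‖x‖ ^ p) := by
      have h2 : 1 + ‖x‖ ≤ 2 * max 1 ‖x‖ := by
        linarith [le_max_left 1 ‖x‖, le_max_right 1 ‖x‖]
      refine (Real.rpow_le_rpow (by positivity) h2 hp.le).trans ?_
      rw [Real.mul_rpow (by norm_num) (by positivity)]
      gcongr
      have h3 : 0 ≤ ‖x‖ ^ p := by positivity
      rcases max_choice 1 ‖x‖ with h | h <;> rw [h]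
      · rw [Real.one_rpow]; linarith
      · linarith
    have h4 : (1 + ‖x‖ ^ p)⁻¹ ≤ 2 ^ p * (1 + ‖x‖) ^ (-p) := by
      rw [Real.rpow_neg (by positivity), ← div_eq_mul_inv, inv_eq_one_div,
        div_le_div_iff₀ (by positivity) (by positivity), one_mul]
      exact h1
    rw [norm_smul, Real.norm_of_nonneg (by positivity)]
    calc (1 + ‖x‖ ^ p)⁻¹ * ‖u x‖ ≤ (2 ^ p * (1 + ‖x‖) ^ (-p)) * B := by
          gcongr
          exact hB x
      _ = _ := by ring

lemma isFracLaplacian_hypersingular [Nontrivial (EuclideanSpace ℝ (Fin n))] {a b c M B : ℝ}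
    (hs0 : 0 < s) (hs1 : s < 1) (has : a < 2 * s) (hsab : 2 * s < a + b)
    (hc : ∀ ξ : EuclideanSpace ℝ (Fin n), (2 * Real.pi * ‖ξ‖) ^ (2 * s) = c * fracSymbol s ξ)
    {u : EuclideanSpace ℝ (Fin n) → ℂ} (hu : Continuous u) (hB : ∀ x, ‖u x‖ ≤ B)
    (h : ∀ x y, ‖symDiff₂ u y x‖ ≤ M * diffWeight a b 1 y) :
    IsFracLaplacian s u (c • hypersingular s u) := by
  refine ⟨memLs_of_bounded hs0 hu hB, fun φ => ?_⟩
  have hφ : schwartzFracLaplacian s φ = c • hypersingular s φ :=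
    funext fun x => fourierInv_fracMultiplier hs0 hs1 hc φ x
  refine ⟨?_, ?_, ?_⟩
  · refine φ.integrable.bdd_mul
      (c := ‖c‖ * (M * ∫ y : EuclideanSpace ℝ (Fin n), fracKernel s y * diffWeight a b 1 y))
      ((continuous_hypersingular has hsab hu h).const_smul c).aestronglyMeasurable
      (ae_of_all _ fun x => ?_)
    rw [Pi.smul_apply, norm_smul]
    exact mul_le_mul_of_nonneg_left (norm_hypersingular_le has hsab (h x)) (norm_nonneg c)
  · rw [hφ]
    -- The hypersingular integral of `φ` is integrable, being a marginal of a jointly integrable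
    -- function.
    exact ((integrable_prod_fracKernel_smul_symDiff₂ hs0 hs1 φ).integral_prod_left.smul c).bdd_mul
      (c := B) hu.aestronglyMeasurable (ae_of_all _ hB)
  · rw [hφ]
    simp only [Pi.smul_apply, smul_mul_assoc, mul_smul_comm]
    rw [integral_smul, integral_smul,
      integral_hypersingular_mul hs0 hs1 has hsab hu hB h φ]

/-- Second-difference bounds on all derivatives of `u` up to order `m` yield the Hölder regularity
of its fractional Laplacian. -/
lemma exists_isFracLaplacian [Nontrivial (EuclideanSpace ℝ (Fin n))] {m : ℕ} {a b : ℝ}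
    (hs0 : 0 < s) (hs1 : s < 1) (has : a < 2 * s) (hsab : 2 * s < a + b) :
    ∃ C : ℝ≥0, 0 < C ∧ ∀ (u : EuclideanSpace ℝ (Fin n) → ℂ) (M : ℝ≥0), ContDiff ℝ m u →
      (∀ x, ‖u x‖ ≤ M) →
      (∀ j ≤ m, ∀ x y, ‖symDiff₂ (iteratedFDeriv ℝ j u) y x‖ ≤ M * diffWeight a b 1 y) →
      (∀ x x' y, ‖symDiff₂ (iteratedFDeriv ℝ m u) y x - symDiff₂ (iteratedFDeriv ℝ m u) y x'‖ ≤
        M * diffWeight a b ‖x - x'‖ y) →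
      ∃ g : EuclideanSpace ℝ (Fin n) → ℂ, IsFracLaplacian s u g ∧
        MemHolderSpace m (a + b - 2 * s) g ∧
        holderSpaceNorm m (a + b - 2 * s) g ≤ C * M := by
  obtain ⟨c, hc0, hc⟩ := exists_fracSymbol_eq (V := EuclideanSpace ℝ (Fin n)) hs0 hs1
  set I := ∫ y : EuclideanSpace ℝ (Fin n), fracKernel s y * diffWeight a b 1 y
  have hI : 0 ≤ I := integral_nonneg fun y =>
    mul_nonneg (fracKernel_nonneg s y) (diffWeight_nonneg a b zero_le_one y)
  -- With `I + 1` in place of `I`, the constant is positive from `0 ≤ I` alone.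
  set K : ℝ≥0 := ⟨c * (I + 1), by positivity⟩
  have hK : 0 < K := NNReal.coe_pos.1 (by change 0 < c * (I + 1); positivity)
  refine ⟨(m + 2) * K, by positivity, fun u M hu hB h h' => ⟨c • hypersingular s u, ?_⟩⟩
  have hsd : ∀ x y, ‖symDiff₂ u y x‖ ≤ M * diffWeight a b 1 y := fun x y => by
    have := h 0 (Nat.zero_le m) x y
    rw [iteratedFDeriv_zero_eq_comp] at this
    rwa [norm_symDiff₂_comp_linearIsometryEquiv] at this
  have hL := contDiff_hypersingular has hsab hu h
  have hD : ∀ j ≤ m, ∀ x, iteratedFDeriv ℝ j (c • hypersingular s u) x =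
      c • hypersingular s (iteratedFDeriv ℝ j u) x := fun j hj x => by
    rw [iteratedFDeriv_const_smul_apply (hL.of_le (by exact_mod_cast hj)).contDiffAt,
      iteratedFDeriv_hypersingular has hsab hu h hj]
  have hcK : c * (M * I) ≤ (K * M : ℝ≥0) := by
    have : ((K * M : ℝ≥0) : ℝ) = c * (I + 1) * M := rfl
    rw [this]
    have : 0 ≤ c * M := by positivity
    linarith
  have hnorm : holderSpaceNorm m (a + b - 2 * s) (c • hypersingular s u) ≤
      ((m + 2 : ℝ≥0) * (K * M) : ℝ≥0) := by
    refine holderSpaceNorm_le (by linarith) (fun j hj x => ?_) (fun x x' => ?_)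
    · rw [hD j hj, norm_smul, Real.norm_of_nonneg hc0.le]
      exact (mul_le_mul_of_nonneg_left (norm_hypersingular_le has hsab (h j hj x)) hc0.le).trans hcK
    · rw [hD m le_rfl, hD m le_rfl, ← smul_sub, norm_smul, Real.norm_of_nonneg hc0.le]
      refine (mul_le_mul_of_nonneg_left (norm_hypersingular_sub_le has hsab
        (hu.continuous_iteratedFDeriv le_rfl) (h m le_rfl) h' x x') hc0.le).trans ?_
      rw [← mul_assoc]
      exact mul_le_mul_of_nonneg_right hcK (by positivity)
  refine ⟨isFracLaplacian_hypersingular hs0 hs1 has hsab hc hu.continuous hB hsd,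
    ⟨hL.const_smul c, hnorm.trans_lt ENNReal.coe_lt_top⟩, hnorm.trans_eq ?_⟩
  push_cast
  ring

end Main

end

theorem mainTheorem2 (n k : ℕ) (hn : 1 ≤ n) (s α : ℝ) (hs0 : 0 < s) (hs1 : s < 1)
    (hα0 : 0 < α) (hα1 : α ≤ 1) :
    (2 * s < α →
      ∃ C : ℝ≥0, 0 < C ∧ ∀ u : EuclideanSpace ℝ (Fin n) → ℂ, MemHolderSpace k α u →
        ∃ g : EuclideanSpace ℝ (Fin n) → ℂ, IsFracLaplacian s u g ∧
          MemHolderSpace k (α - 2 * s) g ∧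
          holderSpaceNorm k (α - 2 * s) g ≤ C * holderSpaceNorm k α u) ∧
    (α < 2 * s → 2 * s < α + 1 → 1 ≤ k →
      ∃ C : ℝ≥0, 0 < C ∧ ∀ u : EuclideanSpace ℝ (Fin n) → ℂ, MemHolderSpace k α u →
        ∃ g : EuclideanSpace ℝ (Fin n) → ℂ, IsFracLaplacian s u g ∧
          MemHolderSpace (k - 1) (α - 2 * s + 1) g ∧
          holderSpaceNorm (k - 1) (α - 2 * s + 1) g ≤ C * holderSpaceNorm k α u) := by
  have : Nontrivial (EuclideanSpace ℝ (Fin n)) :=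
    Module.nontrivial_of_finrank_pos (R := ℝ) (by rw [finrank_euclideanSpace_fin]; exact hn)
  -- The `4` is a factor `2` from interpolating the lower derivatives times a factor `2` from the
  -- second-difference bounds. The sup bound is weakened to match, so that one `M` serves every
  -- hypothesis of `exists_isFracLaplacian`.
  have bounded : ∀ {u : EuclideanSpace ℝ (Fin n) → ℂ}, MemHolderSpace k α u → ∀ x,
      ‖u x‖ ≤ (4 * (holderSpaceNorm k α u).toNNReal : ℝ≥0) := fun hu x => by
    have := hu.norm_iteratedFDeriv_le (Nat.zero_le k) x
    rw [norm_iteratedFDeriv_zero] at this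
    refine this.trans (NNReal.coe_le_coe.2 (le_mul_of_one_le_left zero_le ?_))
    norm_num
  have coe_norm : ∀ {u : EuclideanSpace ℝ (Fin n) → ℂ} (C : ℝ≥0), MemHolderSpace k α u →
      (C : ℝ≥0∞) * (4 * (holderSpaceNorm k α u).toNNReal : ℝ≥0) =
        (4 * C : ℝ≥0) * holderSpaceNorm k α u := fun C hu => by
    push_cast
    rw [ENNReal.coe_toNNReal hu.2.ne]
    ring
  have holder : ∀ {u : EuclideanSpace ℝ (Fin n) → ℂ}, MemHolderSpace k α u → ∀ j ≤ k, ∀ x x',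
      ‖iteratedFDeriv ℝ j u x - iteratedFDeriv ℝ j u x'‖ ≤
        2 * (holderSpaceNorm k α u).toNNReal * ‖x - x'‖ ^ α := fun hu j hj =>
    norm_iteratedFDeriv_sub_le hα0.le hα1 (NNReal.coe_nonneg _) hu.1
      (fun j hj => hu.norm_iteratedFDeriv_le hj) (hu.norm_iteratedFDeriv_sub_le hα0) hj
  constructor
  · intro hsα
    obtain ⟨C, hC, H⟩ := exists_isFracLaplacian (n := n) (m := k) (a := 0) (b := α) hs0 hs1
      (by linarith) (by linarith)
    rw [zero_add] at H
    refine ⟨4 * C, by positivity, fun u hu => ?_⟩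
    rw [← coe_norm C hu]
    set M := (holderSpaceNorm k α u).toNNReal
    have e : ((4 * M : ℝ≥0) : ℝ) = 2 * (2 * M) := by push_cast; ring
    refine H u _ hu.1 (bounded hu) (fun j hj x y => ?_) (fun x x' y => ?_) <;> rw [e]
    · exact norm_symDiff₂_le_diffWeight_zero (by positivity)
        (fun x => (hu.norm_iteratedFDeriv_le hj x).trans
          (le_mul_of_one_le_left M.coe_nonneg one_le_two)) (holder hu j hj) x y
    · exact norm_symDiff₂_sub_le_diffWeight_zero (by positivity) (holder hu k le_rfl) x x' y
  · intro hαs hsα hk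
    -- The order `k - 1` leaves one spare derivative: each `iteratedFDeriv ℝ j u` with `j ≤ k - 1`
    -- has an `α`-Hölder derivative.
    obtain ⟨C, hC, H⟩ := exists_isFracLaplacian (n := n) (m := k - 1) (a := α) (b := 1) hs0 hs1
      hαs hsα
    rw [add_sub_right_comm] at H
    refine ⟨4 * C, by positivity, fun u hu => ?_⟩
    rw [← coe_norm C hu]
    set M := (holderSpaceNorm k α u).toNNReal
    have e : ((4 * M : ℝ≥0) : ℝ) = 2 * (2 * M) := by push_cast; ring
    have hd : ∀ j ≤ k - 1, Differentiable ℝ (iteratedFDeriv ℝ j u) := fun j hj =>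
      (contDiff_one_iteratedFDeriv hu.1 (by omega)).differentiable one_ne_zero
    have hh : ∀ j ≤ k - 1, ∀ x x',
        ‖fderiv ℝ (iteratedFDeriv ℝ j u) x - fderiv ℝ (iteratedFDeriv ℝ j u) x'‖ ≤
          2 * M * ‖x - x'‖ ^ α := fun j hj x x' => by
      rw [norm_fderiv_iteratedFDeriv_sub]
      exact holder hu (j + 1) (by omega) x x'
    refine H u _ (hu.1.of_le (by exact_mod_cast Nat.sub_le k 1)) (bounded hu)
      (fun j hj x y => ?_) (fun x x' y => ?_) <;> rw [e]
    · exact norm_symDiff₂_le_diffWeight_one (by positivity) (hd j hj) (holder hu j (by omega))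
        (hh j hj) x y
    · exact norm_symDiff₂_sub_le_diffWeight_one (by positivity) (hd _ le_rfl) (hh _ le_rfl) x x' y
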